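/- Let $n\ge 2$ and let $G=([n],\omega)$ be a consistently oriented weighted cycle graph: $[n]=\mathbb{Z}/n\mathbb{Z}$ and $\omega:[n]\times[n]\to[0,\infty]$ satisfies, for all $i\neq j$, $\omega(i,j)<\infty$ if and only if $j=i+1 \pmod n$. Let $d(x,y)$ be the shortest path function of $G$, that is, the infimum of $\sum_{k<m}\omega(x_k,x_{k+1})$ over all finite sequences $x=x_0,x_1,\dots,x_m=y$ (the constant path, $m=0$, has weight $0$); the path completion of $G$ is $P(G)=([n],d)$. For $\delta\in[0,\infty]$ let $\mathfrak{D}_\delta(G)$ be the Dowker source complex of $P(G)$ at scale $\delta$: its simplices are the nonempty sets $\sigma\subseteq[n]$ for which there is a vertex $v$ with $d(v,x)\le\delta$ for all $x\in\sigma$. Let $H_1(\mathfrak{D}_\delta(G))$ be its first simplicial homology with real coefficients, with the maps $H_1(\mathfrak{D}_\delta(G))\to H_1(\mathfrak{D}_{\delta'}(G))$, $\delta\le\delta'$, induced by inclusion. Put $$a=\max_i\,\omega(i,i+1),\qquad b=\min_{i\neq j}\max\{d(i,j),d(j,i)\}.$$ Then: 1. For every $\delta\in[0,\infty]$, $H_1(\mathfrak{D}_\delta(G))$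 contains a nonzero class if and only if $a\le\delta<b$. 2. If $a\le\delta<b$, then $H_1(\mathfrak{D}_\delta(G))$ has dimension $1$. 3. Every nonzero class $c\in H_1(\mathfrak{D}_\delta(G))$ is born at $a$ and dies at $b$: for $\delta'\le\delta$, $c$ lies in the image of $H_1(\mathfrak{D}_{\delta'}(G))$ if and only if $a\le\delta'$; for $\delta'\ge\delta$, the image of $c$ in $H_1(\mathfrak{D}_{\delta'}(G))$ is zero if and only if $b\le\delta'$. 4. The value $b$ is the first scale at which two vertices see each other in $P(G)$: for every $\delta\in[0,\infty]$, $b\le\delta$ if and only if there are $i\neq j$ with $d(i,j)\le\delta$ and $d(j,i)\le\delta$. -/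

import Mathlib

open scoped ENNReal

noncomputable section

/-! ### Simplicial homology of an abstract simplicial complex with real coefficients -/

namespace SimplicialHomology

variable {V : Type*}

/-- Formal real combinations of vertex sets form an abelian group. (A direct path to Mathlib's own
instance, which makes quotients of subspaces of this space available.) -/
instance : AddCommGroup (Finset V →₀ ℝ) :=
  Finsupp.instAddCommGroup

/-- The space `C_k(K)` of `k`-chains: linear combinations of faces with `k + 1` vertices. -/
def chains (K : PreAbstractSimplicialComplex V) (k : ℕ) : Submodule ℝ (Finset V →₀ ℝ) :=
  Finsupp.supported ℝ ℝ {σ : Finset V | σ ∈ K ∧ σ.card = k + 1}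

theorem chains_mono {K L : PreAbstractSimplicialComplex V} (h : K ≤ L) (k : ℕ) :
    chains K k ≤ chains L k :=
  Finsupp.supported_mono fun _ hσ => ⟨h hσ.1, hσ.2⟩

variable [LinearOrder V]

/-- The alternating sum of the facets of a simplex `σ = [v₀ < v₁ < ⋯ < v_k]`: the vertex `v = v_i`
has exactly `i` smaller vertices in `σ`, so it contributes `(-1)^i [v₀, …, v̂_i, …, v_k]`. -/
def altFaces (σ : Finset V) : Finset V →₀ ℝ :=
  ∑ v ∈ σ, Finsupp.single (σ.erase v) ((-1 : ℝ) ^ (σ.filter (· < v)).card)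

/-- The boundary map `∂_k`, written on the space of all formal real combinations of finite vertex
sets. The homology is unreduced: `∂_0 = 0`. -/
def bdry : ℕ → ((Finset V →₀ ℝ) →ₗ[ℝ] (Finset V →₀ ℝ))
  | 0 => 0
  | _ + 1 => Finsupp.linearCombination ℝ altFaces

/-- The space of `k`-cycles: the kernel of `∂_k` on `C_k(K)`. -/
def cycles (K : PreAbstractSimplicialComplex V) (k : ℕ) : Submodule ℝ (Finset V →₀ ℝ) :=
  chains K k ⊓ LinearMap.ker (bdry k)

/-- The space of `k`-boundaries: the image of `C_{k+1}(K)` under `∂_{k+1}`. -/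
def boundaries (K : PreAbstractSimplicialComplex V) (k : ℕ) : Submodule ℝ (Finset V →₀ ℝ) :=
  (chains K (k + 1)).map (bdry (k + 1))

/-- The `k`-th simplicial homology `H_k(K) = ker ∂_k / im ∂_{k+1}` with real coefficients. -/
abbrev Homology (K : PreAbstractSimplicialComplex V) (k : ℕ) : Type _ :=
  cycles K k ⧸ (boundaries K k).submoduleOf (cycles K k)

theorem cycles_mono {K L : PreAbstractSimplicialComplex V} (h : K ≤ L) (k : ℕ) :
    cycles K k ≤ cycles L k :=
  inf_le_inf_right _ (chains_mono h k)

theorem boundaries_mono {K L : PreAbstractSimplicialComplex V} (h : K ≤ L) (k : ℕ) :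
    boundaries K k ≤ boundaries L k :=
  Submodule.map_mono (chains_mono h (k + 1))

/-- The map `H_k(K) → H_k(L)` induced by an inclusion `K ⊆ L`. -/
def homologyMap {K L : PreAbstractSimplicialComplex V} (h : K ≤ L) (k : ℕ) :
    Homology K k →ₗ[ℝ] Homology L k :=
  Submodule.mapQ _ _ (Submodule.inclusion (cycles_mono h k))
    (fun _ hx => boundaries_mono h k hx)

theorem bdry_altFaces (σ : Finset V) (k : ℕ) : bdry (k + 1) (altFaces σ) = 0 := by
  classical
  simp only [bdry, altFaces, map_sum, Finsupp.linearCombination_single, Finset.smul_sum,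
    Finsupp.smul_single, smul_eq_mul]
  rw [Finset.sum_sigma']
  refine Finset.sum_involution (fun p _ => ⟨p.2, p.1⟩) ?_ ?_ ?_ ?_
  · rintro ⟨v, w⟩ h
    simp only [Finset.mem_sigma, Finset.mem_erase] at h
    obtain ⟨hv, hwv, hw⟩ := h
    simp only
    rw [Finset.erase_right_comm, ← Finsupp.single_add]
    suffices hs : (-1 : ℝ) ^ (σ.filter (· < v)).card * (-1) ^ ((σ.erase v).filter (· < w)).card +
        (-1) ^ (σ.filter (· < w)).card * (-1) ^ ((σ.erase w).filter (· < v)).card = 0 by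
      rw [hs, Finsupp.single_zero]
    have key : ∀ a b : V, a < b → a ∈ σ →
        ((σ.erase a).filter (· < b)).card + 1 = (σ.filter (· < b)).card ∧
        ((σ.erase b).filter (· < a)).card = (σ.filter (· < a)).card := by
      intro a b hab ha
      constructor
      · rw [Finset.filter_erase, Finset.card_erase_add_one]
        simp [ha, hab]
      · rw [Finset.filter_erase, Finset.erase_eq_of_notMem]
        simp [hab.le]
    rcases lt_or_gt_of_ne hwv with h | h
    · obtain ⟨h1, h2⟩ := key w v h hw
      rw [h2, ← h1, pow_succ]; ring
    · obtain ⟨h1, h2⟩ := key v w h hv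
      rw [h2, ← h1, pow_succ]; ring
  · rintro ⟨v, w⟩ h _ h'
    simp only [Finset.mem_sigma, Finset.mem_erase] at h
    simp only [Sigma.mk.injEq, heq_eq_eq] at h'
    exact h.2.1 h'.1
  · rintro ⟨v, w⟩ h
    simp only [Finset.mem_sigma, Finset.mem_erase] at h ⊢
    exact ⟨h.2.2, h.2.1.symm, h.1⟩
  · rintro ⟨v, w⟩ _
    rfl

/-- `∂ ∘ ∂ = 0`: every boundary is a cycle. -/
theorem boundaries_le_cycles (K : PreAbstractSimplicialComplex V) (k : ℕ) :
    boundaries K k ≤ cycles K k := by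
  rintro _ ⟨c, hc, rfl⟩
  have hc' := (Finsupp.mem_supported _ _).1 hc
  refine ⟨?_, ?_⟩
  · simp only [bdry, Finsupp.linearCombination_apply, Finsupp.sum]
    refine Submodule.sum_mem _ fun σ hσ => Submodule.smul_mem _ _ ?_
    obtain ⟨h1, h2⟩ := hc' hσ
    refine Submodule.sum_mem _ fun v hv => Finsupp.single_mem_supported ℝ _ ⟨?_, ?_⟩
    · refine (K.isRelLowerSet_faces h1).2 (Finset.erase_subset v σ) ?_
      rw [← Finset.card_pos, Finset.card_erase_of_mem hv]
      omega
    · rw [Finset.card_erase_of_mem hv]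
      omega
  · cases k with
    | zero => simp [bdry]
    | succ k =>
      have h : bdry (V := V) (k + 1 + 1) = Finsupp.linearCombination ℝ altFaces := rfl
      change bdry (k + 1) (bdry (k + 1 + 1) c) = 0
      rw [h, Finsupp.linearCombination_apply, Finsupp.sum, map_sum]
      exact Finset.sum_eq_zero fun σ _ => by rw [map_smul, bdry_altFaces, smul_zero]

end SimplicialHomology

/-! ### Weighted digraphs, path completion, Dowker filtration -/

namespace DowkerPersistence

variable {V : Type*}

/-- The shortest path function of a weighted digraph `(V, ω)`: the infimum over all finite sequences
`p 0 = x, p 1, …, p m = y` of the sum of the weights `ω (p k) (p (k + 1))`. The constant path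
`m = 0` has weight `0`. The weighted digraph `(V, pathDist ω)` is the path completion. -/
def pathDist (ω : V → V → ℝ≥0∞) (x y : V) : ℝ≥0∞ :=
  ⨅ (m : ℕ) (p : Fin (m + 1) → V) (_ : p 0 = x ∧ p (Fin.last m) = y),
    ∑ k : Fin m, ω (p k.castSucc) (p k.succ)

/-- The Dowker source complex of a relation `R`: a nonempty finite set of vertices is a face if
some common source `v` is related to all its elements. -/
def dowkerComplex (R : V → V → Prop) : PreAbstractSimplicialComplex V where
  faces := {σ | σ.Nonempty ∧ ∃ v, ∀ x ∈ σ, R v x}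
  isRelLowerSet_faces := fun _ hσ =>
    ⟨hσ.1, fun _ hτ hne => ⟨hne, hσ.2.imp fun _ hv x hx => hv x (hτ hx)⟩⟩

/-- The Dowker filtration of a weighted digraph at scale `δ`: the Dowker source complex of the
relation "distance at most `δ`" on the path completion. -/
def dowkerFiltration (ω : V → V → ℝ≥0∞) (δ : ℝ≥0∞) : PreAbstractSimplicialComplex V :=
  dowkerComplex fun x y => pathDist ω x y ≤ δ

theorem dowkerFiltration_mono (ω : V → V → ℝ≥0∞) {δ δ' : ℝ≥0∞} (h : δ ≤ δ') :
    dowkerFiltration ω δ ≤ dowkerFiltration ω δ' :=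
  fun _ hσ => ⟨hσ.1, hσ.2.imp fun _ hv x hx => (hv x hx).trans h⟩

/-- The `k`-th Dowker homology at scale `δ`, with real coefficients. -/
abbrev DowkerHomology [LinearOrder V] (ω : V → V → ℝ≥0∞) (k : ℕ) (δ : ℝ≥0∞) : Type _ :=
  SimplicialHomology.Homology (dowkerFiltration ω δ) k

/-- The structure map `H_k(D_δ) → H_k(D_δ')` of the persistence module, for `δ ≤ δ'`. -/
abbrev dowkerMap [LinearOrder V] (ω : V → V → ℝ≥0∞) (k : ℕ) {δ δ' : ℝ≥0∞} (h : δ ≤ δ') :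
    DowkerHomology ω k δ →ₗ[ℝ] DowkerHomology ω k δ' :=
  SimplicialHomology.homologyMap (dowkerFiltration_mono ω h) k

/-- A weighted digraph on the vertices `0, …, n - 1` is a consistently oriented cycle graph if its
edges (pairs of distinct vertices of finite weight) are exactly the pairs `(i, i + 1)`, where the
addition in `Fin n` is modulo `n`. Self loops are irrelevant and left unrestricted. -/
def IsConsistentCycle {n : ℕ} [NeZero n] (ω : Fin n → Fin n → ℝ≥0∞) : Prop :=
  ∀ i j : Fin n, i ≠ j → (ω i j < ∞ ↔ j = i + 1)

/-- The largest edge weight of a cycle graph. -/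
def maxEdgeWeight {n : ℕ} [NeZero n] (ω : Fin n → Fin n → ℝ≥0∞) : ℝ≥0∞ :=
  ⨆ i : Fin n, ω i (i + 1)

/-- The minimum over all pairs `i ≠ j` of `max {d(i,j), d(j,i)}`, where `d` is the weight function
of the path completion. -/
def minMutualDist {n : ℕ} (ω : Fin n → Fin n → ℝ≥0∞) : ℝ≥0∞ :=
  ⨅ (i : Fin n) (j : Fin n) (_ : i ≠ j), max (pathDist ω i j) (pathDist ω j i)

end DowkerPersistence

end

open DowkerPersistence

/-! Only the edges `i → i + 1` have finite weight, so `d(v, y)` is the weight of the arc from `v` to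
`y` (`pathDist_eq_arcWeight`). Coning from a common source `v` makes every 1-chain homologous to a
combination of cycle edges of weight at most `δ` (`chains_le_boundaries_sup_span`). A cycle of that
form has constant coefficients, so it is a multiple of `fundamentalChain`, and it vanishes if an
edge is missing, that is, if `δ < a`.

For `a ≤ δ` the fundamental chain is a cycle. If distinct `i`, `j` see each other, the arcs `i → j`
and `j → i` are homologous to opposite copies of one edge, so the chain bounds
(`fundamentalChain_mem_boundaries`). Otherwise signed arc length is a cocycle whose value on the
fundamental chain is `n ≠ 0` (`fundamentalChain_notMem_boundaries`). One and the same chain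
generates at all scales, which gives birth and death. -/

namespace SimplicialHomology

/-! ### Oriented edges and triangles as simplicial chains. -/

variable {V : Type*} [LinearOrder V]

/-- The oriented edge from `x` to `y` as a chain; it vanishes for `x = y`. -/
noncomputable def orientedEdge (x y : V) : Finset V →₀ ℝ :=
  if x < y then Finsupp.single {x, y} 1 else if y < x then -Finsupp.single {x, y} 1 else 0

theorem orientedEdge_of_lt {x y : V} (h : x < y) :
    orientedEdge x y = Finsupp.single {x, y} 1 := if_pos h

theorem orientedEdge_self (x : V) : orientedEdge x x = 0 := by simp [orientedEdge]

theorem orientedEdge_swap (x y : V) : orientedEdge y x = -orientedEdge x y := by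
  rcases lt_trichotomy x y with h | rfl | h
  · simp [orientedEdge, h, h.not_gt, Finset.pair_comm]
  · simp [orientedEdge_self]
  · simp [orientedEdge, h, h.not_gt, Finset.pair_comm]

theorem altFaces_pair {x y : V} (h : x < y) :
    altFaces ({x, y} : Finset V) = Finsupp.single {y} 1 - Finsupp.single {x} 1 := by
  have h1 : ({x, y} : Finset V).erase x = {y} := by
    ext a; simp only [Finset.mem_erase, Finset.mem_insert, Finset.mem_singleton]
    constructor
    · tauto
    · rintro rfl; exact ⟨h.ne', Or.inr rfl⟩
  have h2 : ({x, y} : Finset V).erase y = {x} := by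
    ext a; simp only [Finset.mem_erase, Finset.mem_insert, Finset.mem_singleton]
    constructor
    · tauto
    · rintro rfl; exact ⟨h.ne, Or.inl rfl⟩
  rw [altFaces, Finset.sum_pair h.ne, h1, h2]
  simp [Finset.filter_insert, Finset.filter_singleton, h, h.not_gt, sub_eq_add_neg]

theorem altFaces_triple {x y z : V} (hxy : x < y) (hyz : y < z) :
    altFaces ({x, y, z} : Finset V) = orientedEdge x y + orientedEdge y z + orientedEdge z x := by
  have hxz := hxy.trans hyz
  have h1 : ({x, y, z} : Finset V).erase x = {y, z} := by
    ext a; simp only [Finset.mem_erase, Finset.mem_insert, Finset.mem_singleton]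
    constructor
    · tauto
    · rintro (rfl | rfl)
      · exact ⟨hxy.ne', by simp⟩
      · exact ⟨hxz.ne', by simp⟩
  have h2 : ({x, y, z} : Finset V).erase y = {x, z} := by
    ext a; simp only [Finset.mem_erase, Finset.mem_insert, Finset.mem_singleton]
    constructor
    · tauto
    · rintro (rfl | rfl)
      · exact ⟨hxy.ne, by simp⟩
      · exact ⟨hyz.ne', by simp⟩
  have h3 : ({x, y, z} : Finset V).erase z = {x, y} := by
    ext a; simp only [Finset.mem_erase, Finset.mem_insert, Finset.mem_singleton]
    constructor
    · tauto
    · rintro (rfl | rfl)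
      · exact ⟨hxz.ne, by simp⟩
      · exact ⟨hyz.ne, by simp⟩
  rw [altFaces, Finset.sum_insert (by simp [hxy.ne, hxz.ne]), Finset.sum_pair hyz.ne, h1, h2, h3,
    orientedEdge_swap x z, orientedEdge_of_lt hxy, orientedEdge_of_lt hyz, orientedEdge_of_lt hxz]
  have hne : x ≠ y := hxy.ne
  simp [Finset.filter_insert, Finset.filter_singleton, hxy, hyz, hxz, hxy.not_gt, hyz.not_gt,
    hxz.not_gt, hne]
  abel

theorem exists_lt_of_card_eq_two {σ : Finset V} (h : σ.card = 2) : ∃ x y, x < y ∧ σ = {x, y} := by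
  obtain ⟨x, y, hne, rfl⟩ := Finset.card_eq_two.1 h
  rcases lt_or_gt_of_ne hne with h | h
  · exact ⟨x, y, h, rfl⟩
  · exact ⟨y, x, h, Finset.pair_comm x y⟩

theorem exists_lt_lt_of_card_eq_three {σ : Finset V} (h : σ.card = 3) :
    ∃ x y z, x < y ∧ y < z ∧ σ = {x, y, z} := by
  let f := σ.orderEmbOfFin h
  refine ⟨f 0, f 1, f 2, f.strictMono (by decide), f.strictMono (by decide), ?_⟩
  have huniv : (Finset.univ : Finset (Fin 3)) = {0, 1, 2} := rfl
  rw [← σ.image_orderEmbOfFin_univ h, huniv, Finset.image_insert, Finset.image_insert,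
    Finset.image_singleton]

theorem bdry_orientedEdge (x y : V) :
    bdry 1 (orientedEdge x y) = Finsupp.single {y} 1 - Finsupp.single {x} 1 := by
  have key : ∀ x y : V, x < y →
      bdry 1 (orientedEdge x y) = Finsupp.single {y} 1 - Finsupp.single {x} 1 := by
    intro x y h
    rw [orientedEdge_of_lt h, bdry, Finsupp.linearCombination_single, one_smul, altFaces_pair h]
  rcases lt_trichotomy x y with h | rfl | h
  · exact key x y h
  · simp [orientedEdge_self]
  · rw [orientedEdge_swap, map_neg, key y x h, neg_sub]

theorem orientedEdge_mem_chains {K : PreAbstractSimplicialComplex V} {x y : V}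
    (h : ({x, y} : Finset V) ∈ K) : orientedEdge x y ∈ chains K 1 := by
  have key : ∀ x y : V, ({x, y} : Finset V) ∈ K → x < y → orientedEdge x y ∈ chains K 1 := by
    intro x y h hxy
    rw [orientedEdge_of_lt hxy]
    exact Finsupp.single_mem_supported ℝ _ ⟨h, Finset.card_pair hxy.ne⟩
  rcases lt_trichotomy x y with hxy | rfl | hxy
  · exact key x y h hxy
  · rw [orientedEdge_self]; exact zero_mem _
  · rw [orientedEdge_swap]
    exact neg_mem (key y x (Finset.pair_comm x y ▸ h) hxy)

/-- The oriented boundary of a (possibly degenerate) triangle of `K` is a boundary. -/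
theorem triangle_mem_boundaries {K : PreAbstractSimplicialComplex V} {x y z : V}
    (h : ({x, y, z} : Finset V) ∈ K) :
    orientedEdge x y + orientedEdge y z + orientedEdge z x ∈ boundaries K 1 := by
  -- The sum is invariant under rotation and changes sign under transposition, so sorted triples
  -- suffice; degenerate ones give zero.
  have sorted : ∀ x y z : V, ({x, y, z} : Finset V) ∈ K → x < y → y < z →
      orientedEdge x y + orientedEdge y z + orientedEdge z x ∈ boundaries K 1 := by
    intro x y z h hxy hyz
    refine ⟨Finsupp.single {x, y, z} 1, Finsupp.single_mem_supported ℝ _ ⟨h, ?_⟩, ?_⟩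
    · exact Finset.card_eq_three.2 ⟨x, y, z, hxy.ne, (hxy.trans hyz).ne, hyz.ne, rfl⟩
    · rw [bdry, Finsupp.linearCombination_single, one_smul, altFaces_triple hxy hyz]
  have lt_case : ∀ x y z : V, ({x, y, z} : Finset V) ∈ K → x < y →
      orientedEdge x y + orientedEdge y z + orientedEdge z x ∈ boundaries K 1 := by
    intro x y z h hxy
    rcases lt_trichotomy y z with hyz | rfl | hyz
    · exact sorted x y z h hxy hyz
    · simp [orientedEdge_self, orientedEdge_swap x y]
    · rcases lt_trichotomy x z with hxz | rfl | hxz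
      · have := sorted x z y (by rwa [Finset.pair_comm z y]) hxz hyz
        rw [orientedEdge_swap z y, orientedEdge_swap x z, orientedEdge_swap y x]
        convert neg_mem this using 1
        abel
      · simp [orientedEdge_self, orientedEdge_swap x y]
      · have := sorted z x y (by
          rwa [Finset.insert_comm z x, Finset.pair_comm z y]) hxz hxy
        convert this using 1
        abel
  rcases lt_trichotomy x y with hxy | rfl | hxy
  · exact lt_case x y z h hxy
  · simp [orientedEdge_self, orientedEdge_swap x z]
  · have := lt_case y x z (by rwa [Finset.insert_comm y x]) hxy
    rw [orientedEdge_swap y x, orientedEdge_swap z y, orientedEdge_swap x z]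
    convert neg_mem this using 1
    abel

theorem homology_mk_eq_zero_iff {K : PreAbstractSimplicialComplex V} {k : ℕ} (z : cycles K k) :
    (Submodule.Quotient.mk z : Homology K k) = 0 ↔ (z : Finset V →₀ ℝ) ∈ boundaries K k := by
  rw [Submodule.Quotient.mk_eq_zero]
  rfl

end SimplicialHomology

namespace DowkerPersistence

/-! ### Shortest paths in the cycle are arcs. -/

section Arc

variable {n : ℕ} [NeZero n] (ω : Fin n → Fin n → ℝ≥0∞)

/-- The weight of the path `v, v + 1, …, v + m`. -/
noncomputable def arcWeight (v : Fin n) (m : ℕ) : ℝ≥0∞ :=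
  ∑ k ∈ Finset.range m, ω (v + k • 1) (v + k • 1 + 1)

theorem arcWeight_add (v : Fin n) (m m' : ℕ) :
    arcWeight ω v (m + m') = arcWeight ω v m + arcWeight ω (v + m • 1) m' := by
  simp only [arcWeight, Finset.sum_range_add, add_nsmul, add_assoc]

theorem arcWeight_mono (v : Fin n) {m m' : ℕ} (h : m ≤ m') :
    arcWeight ω v m ≤ arcWeight ω v m' := by
  obtain ⟨k, rfl⟩ := Nat.exists_eq_add_of_le h
  rw [arcWeight_add]
  exact le_self_add

theorem weight_le_arcWeight (v : Fin n) {k m : ℕ} (h : k < m) :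
    ω (v + k • 1) (v + k • 1 + 1) ≤ arcWeight ω v m :=
  Finset.single_le_sum (f := fun k => ω (v + k • 1) (v + k • 1 + 1))
    (fun _ _ => zero_le) (Finset.mem_range.2 h)

theorem pathDist_add_nsmul_le (v : Fin n) (m : ℕ) :
    pathDist ω v (v + m • 1) ≤ arcWeight ω v m := by
  refine iInf_le_of_le m (iInf₂_le_of_le (fun k => v + (k : ℕ) • 1) ⟨by simp, by simp⟩ ?_)
  rw [arcWeight, ← Fin.sum_univ_eq_sum_range (fun k => ω (v + k • 1) (v + k • 1 + 1))]
  refine le_of_eq (Finset.sum_congr rfl fun k _ => ?_)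
  simp [succ_nsmul, add_assoc]

open Fin.CommRing in
theorem val_nsmul_one (x : Fin n) : (x : ℕ) • (1 : Fin n) = x := by
  rw [nsmul_one]; exact Fin.cast_val_eq_self x

theorem add_val_nsmul_one (v x : Fin n) : v + ((x - v : Fin n) : ℕ) • (1 : Fin n) = x := by
  rw [val_nsmul_one, add_sub_cancel]

variable {ω}

/-- Triangle inequality for a single first edge. A self loop only adds weight, and an edge other
than `v → v + 1` weighs `∞`. For `w = v + 1` the arc from `v` splits off this edge, unless `y = v`,
where the left side is an empty sum. -/
theorem arcWeight_le_weight_add (hω : IsConsistentCycle ω) (v w y : Fin n) :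
    arcWeight ω v (y - v : Fin n) ≤ ω v w + arcWeight ω w (y - w : Fin n) := by
  by_cases hvw : v = w
  · subst hvw; exact le_add_self
  by_cases hw : w = v + 1
  · subst hw
    by_cases hvy : v = y
    · subst hvy; simp [arcWeight]
    · have h0 : (y - v : Fin n) ≠ 0 := sub_ne_zero.2 (Ne.symm hvy)
      have h1 : ((y - v : Fin n) : ℕ) = 1 + ((y - (v + 1) : Fin n) : ℕ) := by
        have : y - (v + 1) = (y - v) - 1 := by abel
        rw [this, Fin.val_sub_one_of_ne_zero h0]
        have := Fin.val_ne_zero_iff.2 h0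
        omega
      rw [h1, arcWeight_add]
      simp [arcWeight]
  · have : ω v w = ∞ := by
      by_contra h
      exact hw ((hω v w hvw).1 (lt_top_iff_ne_top.2 h))
    simp [this]

/-- In a consistently oriented cycle, the shortest path is the arc. -/
theorem pathDist_eq_arcWeight (hω : IsConsistentCycle ω) (v y : Fin n) :
    pathDist ω v y = arcWeight ω v (y - v : Fin n) := by
  apply le_antisymm
  · conv_lhs => rw [← add_val_nsmul_one v y]
    exact pathDist_add_nsmul_le ω v _
  · refine le_iInf fun m => ?_
    induction m generalizing v with
    | zero =>
      refine le_iInf₂ fun p hp => ?_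
      have : v = y := hp.1.symm.trans hp.2
      subst this
      simp [arcWeight]
    | succ m ih =>
      refine le_iInf₂ fun p hp => ?_
      obtain ⟨rfl, hy⟩ := hp
      rw [Fin.sum_univ_succ]
      refine (arcWeight_le_weight_add hω (p 0) (p 1) y).trans (add_le_add le_rfl ?_)
      exact (ih (p 1)).trans (iInf₂_le (fun k : Fin (m + 1) => p k.succ) ⟨rfl, hy⟩)

end Arc

end DowkerPersistence

/-! ### First homology is spanned by the fundamental chain. -/

namespace DowkerPersistence

open SimplicialHomology

variable {n : ℕ} [NeZero n] {ω : Fin n → Fin n → ℝ≥0∞} {δ : ℝ≥0∞}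

/-- The chain of the oriented edge `i → i + 1`. -/
noncomputable def cycleEdge (i : Fin n) : Finset (Fin n) →₀ ℝ := orientedEdge i (i + 1)

variable (n) in
/-- The fundamental chain of the cycle: the sum of all edges `i → i + 1`. -/
noncomputable def fundamentalChain : Finset (Fin n) →₀ ℝ := ∑ i : Fin n, cycleEdge i

theorem pathDist_self (v : Fin n) : pathDist ω v v = 0 := by
  have := pathDist_add_nsmul_le ω v 0
  simpa [arcWeight] using this

theorem pair_mem_dowkerFiltration {x y : Fin n} (h : pathDist ω x y ≤ δ) :
    ({x, y} : Finset (Fin n)) ∈ dowkerFiltration ω δ := by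
  refine ⟨by simp, x, fun a ha => ?_⟩
  simp only [Finset.mem_insert, Finset.mem_singleton] at ha
  rcases ha with rfl | rfl
  · simp [pathDist_self]
  · exact h

theorem triple_mem_dowkerFiltration {v x y : Fin n} (hx : pathDist ω v x ≤ δ)
    (hy : pathDist ω v y ≤ δ) : ({v, x, y} : Finset (Fin n)) ∈ dowkerFiltration ω δ := by
  refine ⟨by simp, v, fun a ha => ?_⟩
  simp only [Finset.mem_insert, Finset.mem_singleton] at ha
  rcases ha with rfl | rfl | rfl
  · simp [pathDist_self]
  · exact hx
  · exact hy

theorem pathDist_succ_le (i : Fin n) : pathDist ω i (i + 1) ≤ ω i (i + 1) := by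
  have := pathDist_add_nsmul_le ω i 1
  simpa [arcWeight] using this

/-- An edge spanning an arc inside a ball is homologous to the sum of the edges along the arc. -/
theorem orientedEdge_sub_sum_mem_boundaries (v : Fin n) {m : ℕ} (h : arcWeight ω v m ≤ δ) :
    orientedEdge v (v + m • 1) - ∑ k ∈ Finset.range m, cycleEdge (v + k • 1) ∈
      boundaries (dowkerFiltration ω δ) 1 := by
  induction m with
  | zero => simp [orientedEdge_self]
  | succ m ih =>
    have hm := (arcWeight_mono ω v m.le_succ).trans h
    have h1 := ih hm
    -- Fan triangulation from `v`: the triangle `v, v + m, v + (m + 1)` extends the arc by one edge.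
    have h2 := triangle_mem_boundaries (triple_mem_dowkerFiltration
      ((pathDist_add_nsmul_le ω v m).trans hm) ((pathDist_add_nsmul_le ω v (m + 1)).trans h))
    convert sub_mem h1 h2 using 1
    rw [Finset.sum_range_succ, cycleEdge, orientedEdge_swap v (v + (m + 1) • 1), succ_nsmul,
      ← add_assoc]
    abel

theorem orientedEdge_sub_sum_mem_boundaries_of_pathDist_le (hω : IsConsistentCycle ω)
    {v x : Fin n} (h : pathDist ω v x ≤ δ) :
    orientedEdge v x - ∑ k ∈ Finset.range (x - v : Fin n), cycleEdge (v + k • 1) ∈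
      boundaries (dowkerFiltration ω δ) 1 := by
  rw [pathDist_eq_arcWeight hω] at h
  have := orientedEdge_sub_sum_mem_boundaries v h
  rwa [add_val_nsmul_one] at this

/-- Chains of dimension one are generated by boundaries and by the edges of the cycle that are
present at the given scale. -/
theorem chains_le_boundaries_sup_span (hω : IsConsistentCycle ω) :
    chains (dowkerFiltration ω δ) 1 ≤ boundaries (dowkerFiltration ω δ) 1 ⊔
      Submodule.span ℝ (cycleEdge '' {i : Fin n | ω i (i + 1) ≤ δ}) := by
  set S := boundaries (dowkerFiltration ω δ) 1 ⊔
      Submodule.span ℝ (cycleEdge '' {i : Fin n | ω i (i + 1) ≤ δ})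
  have hB : boundaries (dowkerFiltration ω δ) 1 ≤ S := le_sup_left
  have star : ∀ v x : Fin n, pathDist ω v x ≤ δ → orientedEdge v x ∈ S := by
    intro v x h
    rw [← sub_add_cancel (orientedEdge v x)
      (∑ k ∈ Finset.range (x - v : Fin n), cycleEdge (v + k • 1))]
    refine add_mem (hB (orientedEdge_sub_sum_mem_boundaries_of_pathDist_le hω h))
      (Submodule.mem_sup_right (Submodule.sum_mem _ fun k hk => Submodule.subset_span
        ⟨_, ?_, rfl⟩))
    rw [pathDist_eq_arcWeight hω] at h
    exact (weight_le_arcWeight ω v (Finset.mem_range.1 hk)).trans h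
  rw [chains, Finsupp.supported_eq_span_single, Submodule.span_le]
  rintro _ ⟨σ, ⟨⟨-, v, hv⟩, hσ⟩, rfl⟩
  obtain ⟨x, y, hxy, rfl⟩ := exists_lt_of_card_eq_two hσ
  have hx := hv x (by simp)
  have hy := hv y (by simp)
  -- The common source `v` may equal `x` or `y`; degenerate triangles are allowed. Modulo
  -- boundaries, `x → y` equals `v → y` minus `v → x`.
  have h := hB (triangle_mem_boundaries (triple_mem_dowkerFiltration hx hy))
  have := sub_mem (add_mem h (star v y hy)) (star v x hx)
  beta_reduce
  rw [SetLike.mem_coe, ← orientedEdge_of_lt hxy]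
  convert this using 1
  rw [orientedEdge_swap v y]
  abel

theorem bdry_cycleEdge (i : Fin n) :
    bdry 1 (cycleEdge i) = Finsupp.single {i + 1} 1 - Finsupp.single {i} 1 :=
  bdry_orientedEdge _ _

theorem eq_of_forall_succ_eq {α : Type*} {c : Fin n → α} (h : ∀ i, c (i + 1) = c i)
    (i j : Fin n) : c i = c j := by
  have key : ∀ m : ℕ, c (j + m • 1) = c j := by
    intro m
    induction m with
    | zero => simp
    | succ m ih => rw [succ_nsmul, ← add_assoc, h, ih]
  rw [← key (i - j : Fin n), add_val_nsmul_one]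

/-- Modulo boundaries every cycle is a multiple `r` of the fundamental chain, and `r` vanishes if
some edge of the cycle is absent. -/
theorem exists_sub_smul_fundamentalChain_mem (hω : IsConsistentCycle ω)
    {z : Finset (Fin n) →₀ ℝ} (hz : z ∈ cycles (dowkerFiltration ω δ) 1) :
    ∃ r : ℝ, (¬ maxEdgeWeight ω ≤ δ → r = 0) ∧
      z - r • fundamentalChain n ∈ boundaries (dowkerFiltration ω δ) 1 := by
  obtain ⟨b, hb, s, hs, rfl⟩ := Submodule.mem_sup.1 (chains_le_boundaries_sup_span hω hz.1)
  obtain ⟨c, hc, rfl⟩ := (Finsupp.mem_span_image_iff_linearCombination ℝ).1 hs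
  have hsum : Finsupp.linearCombination ℝ cycleEdge c = ∑ i, c i • cycleEdge i :=
    (Finsupp.linearCombination_apply ℝ c).trans (Finsupp.sum_fintype _ _ (by simp))
  have hzero : ∑ i, c i • bdry 1 (cycleEdge i) = 0 := by
    have h1 : bdry 1 b = 0 := (boundaries_le_cycles _ 1 hb).2
    have h2 := LinearMap.mem_ker.1 hz.2
    rw [map_add, h1, zero_add, hsum, map_sum] at h2
    simpa only [map_smul] using h2
  -- The vertex `j + 1` receives `c j` from the incoming edge and `-c (j + 1)` from the outgoing
  -- one.
  have hconst : ∀ j, c (j + 1) = c j := by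
    intro j
    have := DFunLike.congr_fun hzero ({j + 1} : Finset (Fin n))
    simp only [bdry_cycleEdge, Finsupp.finsetSum_apply, Finsupp.smul_apply, Finsupp.sub_apply,
      Finsupp.single_apply, Finset.singleton_inj, add_left_inj, smul_eq_mul, mul_sub, mul_ite,
      mul_one, mul_zero, Finset.sum_sub_distrib, Finset.sum_ite_eq', Finset.mem_univ, if_true,
      Finsupp.coe_zero, Pi.zero_apply] at this
    linarith
  refine ⟨c 0, fun hδ => ?_, ?_⟩
  · rw [maxEdgeWeight, iSup_le_iff, not_forall] at hδ
    obtain ⟨i, hi⟩ := hδ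
    rw [eq_of_forall_succ_eq hconst 0 i]
    by_contra hne
    -- `c` is supported on edges present at scale `δ`, so one absent edge forces the constant
    -- coefficient to vanish.
    exact hi ((Finsupp.mem_supported _ _).1 hc (Finsupp.mem_support_iff.2 hne))
  · convert hb using 1
    rw [hsum, fundamentalChain, Finset.smul_sum, add_sub_assoc, ← Finset.sum_sub_distrib]
    simp [eq_of_forall_succ_eq hconst _ 0]

theorem fundamentalChain_mem_cycles (h : maxEdgeWeight ω ≤ δ) :
    fundamentalChain n ∈ cycles (dowkerFiltration ω δ) 1 := by
  refine ⟨Submodule.sum_mem _ fun i _ => orientedEdge_mem_chains (pair_mem_dowkerFiltration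
    ((pathDist_succ_le i).trans ((le_iSup (fun i => ω i (i + 1)) i).trans h))), ?_⟩
  rw [SetLike.mem_coe, LinearMap.mem_ker, fundamentalChain, map_sum]
  simp only [bdry_cycleEdge, Finset.sum_sub_distrib]
  rw [sub_eq_zero]
  exact Equiv.sum_comp (Equiv.addRight (1 : Fin n)) fun i => Finsupp.single ({i} : Finset (Fin n)) (1 : ℝ)

/-! ### Mutually visible vertices fill the cycle. -/

theorem val_sub_add_val_sub {m : ℕ} {i j : Fin m} (h : i ≠ j) :
    ((j - i : Fin m) : ℕ) + ((i - j : Fin m) : ℕ) = m := by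
  rcases lt_or_gt_of_ne h with h | h
  · rw [Fin.sub_val_of_le h.le, Fin.coe_sub_iff_lt.2 h]; omega
  · rw [Fin.sub_val_of_le h.le, Fin.coe_sub_iff_lt.2 h]; omega

theorem sum_range_add_nsmul_one {M : Type*} [AddCommMonoid M] (f : Fin n → M) (i : Fin n) :
    ∑ k ∈ Finset.range n, f (i + k • 1) = ∑ k, f k := by
  rw [← Fin.sum_univ_eq_sum_range (fun k => f (i + k • 1))]
  simp only [val_nsmul_one]
  exact Equiv.sum_comp (Equiv.addLeft i) f

/-- The edges `i → j` and `j → i` cancel, while the arcs they are homologous to concatenate to one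
full turn. -/
theorem fundamentalChain_mem_boundaries (hω : IsConsistentCycle ω) {i j : Fin n} (hne : i ≠ j)
    (hij : pathDist ω i j ≤ δ) (hji : pathDist ω j i ≤ δ) :
    fundamentalChain n ∈ boundaries (dowkerFiltration ω δ) 1 := by
  have h1 := orientedEdge_sub_sum_mem_boundaries_of_pathDist_le hω hij
  have h2 := orientedEdge_sub_sum_mem_boundaries_of_pathDist_le hω hji
  convert neg_mem (add_mem h1 h2) using 1
  have hrange : Finset.range n = Finset.range ((j - i : Fin n) + (i - j : Fin n) : ℕ) := by
    rw [val_sub_add_val_sub hne]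
  rw [fundamentalChain, ← sum_range_add_nsmul_one _ i, hrange, Finset.sum_range_add]
  have : ∀ k : ℕ, i + ((j - i : Fin n) + k : ℕ) • (1 : Fin n) = j + k • 1 := by
    intro k
    rw [add_nsmul, ← add_assoc, add_val_nsmul_one]
  simp only [this]
  rw [orientedEdge_swap i j]
  abel

/-- A minimum over finitely many pairs is attained. The bound `2 ≤ n` supplies a pair; otherwise the
infimum would be `∞` and the claim would fail at `δ = ∞`. -/
theorem minMutualDist_le_iff (hn : 2 ≤ n) : minMutualDist ω ≤ δ ↔
    ∃ i j : Fin n, i ≠ j ∧ pathDist ω i j ≤ δ ∧ pathDist ω j i ≤ δ := by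
  constructor
  · intro h
    let P := {p : Fin n × Fin n // p.1 ≠ p.2}
    have : Nonempty P := ⟨⟨(⟨0, by omega⟩, ⟨1, by omega⟩), by simp⟩⟩
    obtain ⟨⟨⟨i, j⟩, hij⟩, hmin⟩ := Finite.exists_min
      fun p : P => max (pathDist ω p.1.1 p.1.2) (pathDist ω p.1.2 p.1.1)
    refine ⟨i, j, hij, max_le_iff.1 (le_trans ?_ h)⟩
    exact le_iInf fun x => le_iInf₂ fun y hxy => hmin ⟨(x, y), hxy⟩
  · rintro ⟨i, j, hij, h1, h2⟩
    exact iInf_le_of_le i (iInf₂_le_of_le j hij (max_le h1 h2))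

/-! ### The winding cocycle. -/

/-- The signed length of the arc between `x` and `y`, positive if `x` sees `y` at scale `δ`. -/
noncomputable def signedArcLength (ω : Fin n → Fin n → ℝ≥0∞) (δ : ℝ≥0∞) (x y : Fin n) : ℝ :=
  open Classical in
  if pathDist ω x y ≤ δ then ((y - x : Fin n) : ℕ) else -((x - y : Fin n) : ℕ)

/-- Here `x` lies on the arc from `v` to `y`, so the arc from `x` to `y` is a tail of it. -/
theorem pathDist_le_of_val_sub_le (hω : IsConsistentCycle ω) {v x y : Fin n}
    (hy : pathDist ω v y ≤ δ) (hxy : x - v ≤ y - v) : pathDist ω x y ≤ δ := by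
  rw [pathDist_eq_arcWeight hω] at hy ⊢
  refine le_trans ?_ hy
  have h : ((y - v : Fin n) : ℕ) = (x - v : Fin n) + (y - x : Fin n) := by
    have h1 := Fin.sub_val_of_le hxy
    rw [sub_sub_sub_cancel_right] at h1
    have := Fin.le_def.1 hxy
    omega
  rw [h, arcWeight_add, add_val_nsmul_one]
  exact le_add_self

/-- Without mutually visible vertices the signed arc length is additive on balls. -/
theorem signedArcLength_eq (hω : IsConsistentCycle ω)
    (hδ : ∀ i j : Fin n, i ≠ j → pathDist ω i j ≤ δ → ¬ pathDist ω j i ≤ δ) {v x y : Fin n}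
    (hx : pathDist ω v x ≤ δ) (hy : pathDist ω v y ≤ δ) :
    signedArcLength ω δ x y = ((y - v : Fin n) : ℕ) - ((x - v : Fin n) : ℕ) := by
  rcases le_or_gt (x - v) (y - v) with h | h
  · rw [signedArcLength, if_pos (pathDist_le_of_val_sub_le hω hy h),
      ← Nat.cast_sub (Fin.le_def.1 h), ← Fin.sub_val_of_le h, sub_sub_sub_cancel_right]
  -- Now `y` precedes `x` on the arc from `v`, so `y` sees `x`; by `hδ`, `x` does not see `y`, which
  -- selects the negative branch.
  · have hne : y ≠ x := by rintro rfl; exact h.false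
    rw [signedArcLength, if_neg (hδ y x hne (pathDist_le_of_val_sub_le hω hx h.le)),
      ← neg_sub (((x - v : Fin n) : ℕ) : ℝ), ← Nat.cast_sub (Fin.le_def.1 h.le), ← Fin.sub_val_of_le h.le, sub_sub_sub_cancel_right]

/-- The winding cochain: it measures edges by their signed arc length. -/
noncomputable def windingCochain (ω : Fin n → Fin n → ℝ≥0∞) (δ : ℝ≥0∞) :
    (Finset (Fin n) →₀ ℝ) →ₗ[ℝ] ℝ :=
  Finsupp.linearCombination ℝ fun σ : Finset (Fin n) =>
    ∑ p ∈ σ ×ˢ σ with p.1 < p.2, signedArcLength ω δ p.1 p.2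

/-- On the ball around `v` the cochain is the coboundary of the position function `x ↦ x - v`, so
its values telescope around any triangle in the ball. -/
theorem windingCochain_orientedEdge (hω : IsConsistentCycle ω)
    (hδ : ∀ i j : Fin n, i ≠ j → pathDist ω i j ≤ δ → ¬ pathDist ω j i ≤ δ) {v x y : Fin n}
    (hx : pathDist ω v x ≤ δ) (hy : pathDist ω v y ≤ δ) :
    windingCochain ω δ (orientedEdge x y) = ((y - v : Fin n) : ℕ) - ((x - v : Fin n) : ℕ) := by
  have key : ∀ x y : Fin n, x < y →
      windingCochain ω δ (orientedEdge x y) = signedArcLength ω δ x y := by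
    intro x y hxy
    have : (({x, y} : Finset (Fin n)) ×ˢ ({x, y} : Finset (Fin n))).filter
        (fun p => p.1 < p.2) = {(x, y)} := by
      ext ⟨a, b⟩
      simp only [Finset.mem_filter, Finset.mem_product, Finset.mem_insert, Finset.mem_singleton,
        Prod.mk.injEq]
      constructor
      · rintro ⟨⟨rfl | rfl, rfl | rfl⟩, h⟩
        · exact absurd h (lt_irrefl _)
        · exact ⟨rfl, rfl⟩
        · exact absurd h hxy.not_gt
        · exact absurd h (lt_irrefl _)
      · rintro ⟨rfl, rfl⟩
        exact ⟨⟨Or.inl rfl, Or.inr rfl⟩, hxy⟩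
    rw [orientedEdge_of_lt hxy, windingCochain, Finsupp.linearCombination_single, one_smul, this,
      Finset.sum_singleton]
  rcases lt_trichotomy x y with h | rfl | h
  · rw [key x y h, signedArcLength_eq hω hδ hx hy]
  · simp [orientedEdge_self]
  · rw [orientedEdge_swap, map_neg, key y x h, signedArcLength_eq hω hδ hy hx, neg_sub]

theorem fundamentalChain_notMem_boundaries (hn : 2 ≤ n) (hω : IsConsistentCycle ω)
    (ha : maxEdgeWeight ω ≤ δ)
    (hδ : ∀ i j : Fin n, i ≠ j → pathDist ω i j ≤ δ → ¬ pathDist ω j i ≤ δ) :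
    fundamentalChain n ∉ boundaries (dowkerFiltration ω δ) 1 := by
  intro hmem
  have hker : boundaries (dowkerFiltration ω δ) 1 ≤ LinearMap.ker (windingCochain ω δ) := by
    rw [boundaries, Submodule.map_le_iff_le_comap, chains, Finsupp.supported_eq_span_single,
      Submodule.span_le]
    rintro _ ⟨σ, ⟨⟨-, v, hv⟩, hσ⟩, rfl⟩
    obtain ⟨x, y, z, hxy, hyz, rfl⟩ := exists_lt_lt_of_card_eq_three hσ
    have hx := hv x (by simp)
    have hy := hv y (by simp)
    have hz := hv z (by simp)
    rw [SetLike.mem_coe, Submodule.mem_comap, LinearMap.mem_ker, bdry,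
      Finsupp.linearCombination_single, one_smul, altFaces_triple hxy hyz, map_add, map_add,
      windingCochain_orientedEdge hω hδ hx hy, windingCochain_orientedEdge hω hδ hy hz,
      windingCochain_orientedEdge hω hδ hz hx]
    ring
  have h := LinearMap.mem_ker.1 (hker hmem)
  have hedge : ∀ i : Fin n, windingCochain ω δ (cycleEdge i) = 1 := by
    intro i
    have hi := (pathDist_succ_le i).trans ((le_iSup (fun i => ω i (i + 1)) i).trans ha)
    -- Seen from its own tail the edge has length `(1 : Fin n)`, whose value is 1 because `2 ≤ n`.
    -- The total is therefore `n`.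
    rw [cycleEdge, windingCochain_orientedEdge (v := i) hω hδ (by simp [pathDist_self]) hi]
    simp [Nat.mod_eq_of_lt hn]
  rw [fundamentalChain, map_sum] at h
  simp [hedge] at h
  omega

end DowkerPersistence

/-! ### Birth, death and dimension. -/

open SimplicialHomology in
theorem mainTheorem3 (n : ℕ) [NeZero n] (hn : 2 ≤ n) (ω : Fin n → Fin n → ℝ≥0∞)
    (hω : IsConsistentCycle ω) :
    -- a nontrivial class exists exactly on the half-open interval
    (∀ δ : ℝ≥0∞, (∃ c : DowkerHomology ω 1 δ, c ≠ 0) ↔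
      maxEdgeWeight ω ≤ δ ∧ δ < minMutualDist ω) ∧
    -- it is unique up to scalars there
    (∀ δ : ℝ≥0∞, maxEdgeWeight ω ≤ δ → δ < minMutualDist ω →
      Module.finrank ℝ (DowkerHomology ω 1 δ) = 1) ∧
    -- every nontrivial class is born at the maximum edge weight and dies at the minimum
    -- mutual distance
    (∀ (δ : ℝ≥0∞) (c : DowkerHomology ω 1 δ), c ≠ 0 →
      (∀ (δ' : ℝ≥0∞) (h : δ' ≤ δ),
        c ∈ LinearMap.range (dowkerMap ω 1 h) ↔ maxEdgeWeight ω ≤ δ') ∧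
      (∀ (δ' : ℝ≥0∞) (h : δ ≤ δ'),
        dowkerMap ω 1 h c = 0 ↔ minMutualDist ω ≤ δ')) ∧
    -- the death value is the first scale at which two vertices see each other
    (∀ δ : ℝ≥0∞, minMutualDist ω ≤ δ ↔
      ∃ i j : Fin n, i ≠ j ∧ pathDist ω i j ≤ δ ∧ pathDist ω j i ≤ δ) := by
  have hbdry : ∀ δ, minMutualDist ω ≤ δ →
      fundamentalChain n ∈ boundaries (dowkerFiltration ω δ) 1 := by
    intro δ h
    obtain ⟨i, j, hne, hij, hji⟩ := (minMutualDist_le_iff hn).1 h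
    exact fundamentalChain_mem_boundaries hω hne hij hji
  have hnot : ∀ δ, maxEdgeWeight ω ≤ δ → δ < minMutualDist ω →
      fundamentalChain n ∉ boundaries (dowkerFiltration ω δ) 1 := by
    intro δ ha hb
    refine fundamentalChain_notMem_boundaries hn hω ha fun i j hne hij hji => hb.not_ge ?_
    exact (minMutualDist_le_iff hn).2 ⟨i, j, hne, hij, hji⟩
  have hzero : ∀ δ, ¬ maxEdgeWeight ω ≤ δ → ∀ c : DowkerHomology ω 1 δ, c = 0 := by
    intro δ ha c
    obtain ⟨z, rfl⟩ := Submodule.Quotient.mk_surjective _ c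
    obtain ⟨r, hr, hmem⟩ := exists_sub_smul_fundamentalChain_mem hω z.2
    rw [homology_mk_eq_zero_iff]
    simpa [hr ha] using hmem
  let γ : ∀ δ, maxEdgeWeight ω ≤ δ → DowkerHomology ω 1 δ := fun δ ha =>
    Submodule.Quotient.mk ⟨fundamentalChain n, fundamentalChain_mem_cycles ha⟩
  have hγ : ∀ δ ha, γ δ ha = 0 ↔ minMutualDist ω ≤ δ := by
    intro δ ha
    rw [homology_mk_eq_zero_iff]
    refine ⟨fun h => ?_, hbdry δ⟩
    by_contra hb
    exact hnot δ ha (not_le.1 hb) h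
  have hspan : ∀ δ ha, ∀ c : DowkerHomology ω 1 δ, ∃ r : ℝ, r • γ δ ha = c := by
    intro δ ha c
    obtain ⟨z, rfl⟩ := Submodule.Quotient.mk_surjective _ c
    obtain ⟨r, -, hmem⟩ := exists_sub_smul_fundamentalChain_mem hω z.2
    refine ⟨r, ?_⟩
    rw [← Submodule.Quotient.mk_smul, eq_comm, ← sub_eq_zero, ← Submodule.Quotient.mk_sub,
      homology_mk_eq_zero_iff]
    exact hmem
  -- The same chain represents the generator at every scale.
  have hmap : ∀ δ δ' ha ha' (h : δ ≤ δ'), dowkerMap ω 1 h (γ δ ha) = γ δ' ha' :=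
    fun _ _ _ _ _ => rfl
  have hpos : ∀ δ, ∀ c : DowkerHomology ω 1 δ, c ≠ 0 → maxEdgeWeight ω ≤ δ := by
    intro δ c hc
    by_contra ha
    exact hc (hzero δ ha c)
  refine ⟨fun δ => ⟨?_, ?_⟩, ?_, ?_, fun δ => minMutualDist_le_iff hn⟩
  · rintro ⟨c, hc⟩
    have ha := hpos δ c hc
    refine ⟨ha, not_le.1 fun hb => hc ?_⟩
    obtain ⟨r, rfl⟩ := hspan δ ha c
    rw [(hγ δ ha).2 hb, smul_zero]
  · rintro ⟨ha, hb⟩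
    exact ⟨γ δ ha, fun h => hb.not_ge ((hγ δ ha).1 h)⟩
  · intro δ ha hb
    exact finrank_eq_one (γ δ ha) (fun h => hb.not_ge ((hγ δ ha).1 h)) (hspan δ ha)
  · intro δ c hc
    have ha := hpos δ c hc
    obtain ⟨r, rfl⟩ := hspan δ ha c
    have hr : r ≠ 0 := by rintro rfl; exact hc (zero_smul _ _)
    refine ⟨fun δ' h => ⟨?_, fun ha' => ⟨r • γ δ' ha', ?_⟩⟩, fun δ' h => ?_⟩
    · rintro ⟨c', hc'⟩
      refine hpos δ' c' ?_
      rintro rfl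
      exact hc (by rw [← hc', map_zero])
    · rw [map_smul, hmap δ' δ ha' ha h]
    · rw [map_smul, hmap δ δ' ha (ha.trans h) h, smul_eq_zero, or_iff_right hr, hγ δ' (ha.trans h)]
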